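/- Let $X_1,\dots,X_n$ be independent random vectors in $\mathbb{R}^d$ with common distribution $\mu$, defined on a probability space $(\Omega,\mathcal{F},\mathbb{P})$, and let $\mu_n = n^{-1}\sum_{i=1}^n \delta_{X_i}$ be their empirical measure. Let $\mathcal{A}$ be a non-empty class of Borel subsets of $\mathbb{R}^d$ that is pointwise measurable: there is an at most countable subclass $\mathcal{A}_0\subseteq\mathcal{A}$ such that for every $A\in\mathcal{A}$ there is a sequence $(A_k)_{k\in\mathbb{N}}$ in $\mathcal{A}_0$ with $\mathbf{1}_{A_k}(x)\to\mathbf{1}_A(x)$ for every $x\in\mathbb{R}^d$. Let $\mathbb{A}\subseteq\mathbb{R}^d$ be a Borel set that contains every $A\in\mathcal{A}$, and let $p=\mu(\mathbb{A})$. For $m\in\mathbb{N}$, let $$S_{\mathcal{A}}(m)=\max_{x_1,\dots,x_m\in\mathbb{R}^d}\bigl|\bigl\{\{x_1,\dots,x_m\}\cap A : A\in\mathcal{A}\bigr\}\bigr|$$ be the shattering coefficient of $\mathcal{A}$. Let $\delta\in(0,1)$ and suppose that $np\ge \tfrac{8}{3}\log(3/\delta)$. Then $\sup_{A\in\mathcal{A}}|\mu_n(A)-\mu(A)|$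 is a random variable (that is, measurable), and with probability at least $1-\delta$, $$\sup_{A\in\mathcal{A}}|\mu_n(A)-\mu(A)|\le 2\sqrt{\frac{2p}{n}\bigl[\log(12/\delta)+\log S_{\mathcal{A}}(2n)\bigr]}.$$ -/

import Mathlib

open MeasureTheory ProbabilityTheory Filter Topology

noncomputable section

/-- The shattering coefficient `S_𝒜(n)`: the maximum over `x₁, …, xₙ` of the number of distinct
traces `{x₁, …, xₙ} ∩ A`, `A ∈ 𝒜`. The number of traces is at most `2 ^ n`, so that this is a
supremum of a bounded set of natural numbers, and hence a maximum. -/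
def shatterCoeff {E : Type*} (𝒜 : Set (Set E)) (n : ℕ) : ℕ :=
  ⨆ x : Fin n → E, Set.ncard ((fun A : Set E => Set.range x ∩ A) '' 𝒜)

/-- The empirical measure `n⁻¹ ∑ᵢ δ_{xᵢ}` of the points `x₁, …, xₙ`. -/
def empiricalMeasure {E : Type*} [MeasurableSpace E] {n : ℕ} (x : Fin n → E) : Measure E :=
  (n : ENNReal)⁻¹ • ∑ i, Measure.dirac (x i)

/-- The maximal deviation `sup_{A ∈ 𝒜} |μₙ(A) - μ(A)|` of the empirical measure of `x₁, …, xₙ`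
from the probability measure `μ`. All the terms lie in `[0, 1]`. -/
def maxDeviation {E : Type*} [MeasurableSpace E] (μ : Measure E) (𝒜 : Set (Set E)) {n : ℕ}
    (x : Fin n → E) : ℝ :=
  ⨆ A : 𝒜, |(empiricalMeasure x).real (A : Set E) - μ.real (A : Set E)|

/-- The class `𝒜` is pointwise measurable: it has an at most countable subclass such that the
indicator of every member of `𝒜` is the pointwise limit of indicators of members of the
subclass. -/
def PointwiseMeasurable {E : Type*} (𝒜 : Set (Set E)) : Prop :=
  ∃ 𝒜₀ : Set (Set E), 𝒜₀ ⊆ 𝒜 ∧ 𝒜₀.Countable ∧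
    ∀ A ∈ 𝒜, ∃ B : ℕ → Set E, (∀ k, B k ∈ 𝒜₀) ∧
      ∀ x : E, Tendsto (fun k => (B k).indicator (fun _ => (1 : ℝ)) x) atTop
        (𝓝 (A.indicator (fun _ => (1 : ℝ)) x))

end

/-! ### Traces of the class on a finite sample. -/

section Deterministic

variable {E : Type*}

/-! Pointwise measurability reduces the supremum to a sequence of sets, for which a
Vapnik–Chervonenkis symmetrization works; the point is to keep `p` in the exponent. Write `t` for
the bound and `L = log (12/δ) + log S(2n)`, so that `n t² = 8 p L`.

If `t ≥ 2p`, a deviation above `t` forces `μₙ(𝔸) > 2p`, and a Chernoff bound makes this unlikely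
(`measureReal_two_mul_lt_empiricalMeasure_le`).

If `t < 2p`, Chebyshev's inequality and a ghost sample bound the bad event by 6 times the
probability that two independent empirical measures differ by more than `3t/4` on some set
(`mul_measureReal_exists_abs_sub_gt_le`). Swapping the members of pairs preserves the law and puts
random signs on the differences of indicators, which form at most `S(2n)` vectors. A union bound and
exponential moments finish, since each factor `cosh (l vᵢ)` is dominated by a variable that is
independent of the set and equals 1 when the pair misses 𝔸. Its integral brings in `p` directly,
without conditioning on the number of points in 𝔸
(`measureReal_exists_abs_sum_indicatorDiff_gt_le`). -/

theorem ncard_traces_le {m : ℕ} (𝒜 : Set (Set E)) (x : Fin m → E) :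
    Set.ncard ((fun A : Set E => Set.range x ∩ A) '' 𝒜) ≤ 2 ^ m := by
  calc _ ≤ (𝒫 (Set.range x)).ncard := by
        refine Set.ncard_le_ncard ?_ (Set.finite_range x).powerset
        rintro _ ⟨A, -, rfl⟩
        exact Set.inter_subset_left
    _ = 2 ^ (Set.range x).ncard := Set.ncard_powerset _ (Set.finite_range x)
    _ ≤ 2 ^ m := by
        refine Nat.pow_le_pow_right two_pos ?_
        rw [← Set.image_univ]
        exact (Set.ncard_image_le Set.finite_univ).trans (by simp [Set.ncard_univ])

theorem ncard_traces_le_shatterCoeff {m : ℕ} (𝒜 : Set (Set E)) (x : Fin m → E) :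
    Set.ncard ((fun A : Set E => Set.range x ∩ A) '' 𝒜) ≤ shatterCoeff 𝒜 m := by
  refine le_ciSup (f := fun x : Fin m → E =>
    Set.ncard ((fun A : Set E => Set.range x ∩ A) '' 𝒜)) ⟨2 ^ m, ?_⟩ x
  rintro _ ⟨y, rfl⟩
  exact ncard_traces_le 𝒜 y

theorem finite_traces {m : ℕ} (𝒜 : Set (Set E)) (x : Fin m → E) :
    ((fun A : Set E => Set.range x ∩ A) '' 𝒜).Finite := by
  refine (Set.finite_range x).powerset.subset ?_
  rintro _ ⟨A, -, rfl⟩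
  exact Set.inter_subset_left

theorem one_le_shatterCoeff [Nonempty E] {𝒜 : Set (Set E)} (h : 𝒜.Nonempty) (m : ℕ) :
    1 ≤ shatterCoeff 𝒜 m := by
  obtain ⟨e⟩ := ‹Nonempty E›
  refine le_trans ?_ (ncard_traces_le_shatterCoeff 𝒜 (fun _ : Fin m => e))
  exact (Set.ncard_pos (finite_traces _ _)).2 (h.image _)

/-- The difference of the indicators of `A` at the two members of each pair. -/
noncomputable def indicatorDiff {n : ℕ} (z : Fin n → E × E) (A : Set E) (i : Fin n) : ℝ :=
  A.indicator (fun _ => (1 : ℝ)) (z i).1 - A.indicator (fun _ => (1 : ℝ)) (z i).2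

/-- The vector of differences depends on `A` only through its trace on the `2n` points of the two
samples. This is where `S(2n)` enters. -/
theorem indicatorDiff_image_finite_and_ncard_le {n : ℕ} (𝒜 : Set (Set E)) (z : Fin n → E × E) :
    (indicatorDiff z '' 𝒜).Finite ∧ (indicatorDiff z '' 𝒜).ncard ≤ shatterCoeff 𝒜 (2 * n) := by
  classical
  let e : Fin (2 * n) ≃ Fin n ⊕ Fin n := Fintype.equivOfCardEq (by simp; omega)
  let x : Fin (2 * n) → E := fun j => Sum.elim (fun i => (z i).1) (fun i => (z i).2) (e j)
  have h1 (i : Fin n) : (z i).1 ∈ Set.range x := ⟨e.symm (.inl i), by simp [x]⟩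
  have h2 (i : Fin n) : (z i).2 ∈ Set.range x := ⟨e.symm (.inr i), by simp [x]⟩
  have key : indicatorDiff z '' 𝒜 =
      indicatorDiff z '' ((fun A : Set E => Set.range x ∩ A) '' 𝒜) := by
    rw [Set.image_image]
    refine Set.image_congr fun A _ => ?_
    ext i
    simp [indicatorDiff, Set.indicator, h1, h2]
  rw [key]
  exact ⟨(finite_traces _ _).image _,
    (Set.ncard_image_le (finite_traces _ _)).trans (ncard_traces_le_shatterCoeff _ _)⟩

theorem abs_indicatorDiff_le {n : ℕ} (z : Fin n → E × E) (A : Set E) (i : Fin n) :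
    |indicatorDiff z A i| ≤ 1 := by
  unfold indicatorDiff Set.indicator
  split_ifs <;> simp

end Deterministic

/-! ### Exponential moments of signed sums, with signs counted instead of drawn. -/

section Rademacher

theorem sum_exp_signed_sum {n : ℕ} (v : Fin n → ℝ) (l : ℝ) :
    ∑ b : Fin n → Bool, Real.exp (l * ∑ i, (if b i then v i else -v i)) =
      2 ^ n * ∏ i, Real.cosh (l * v i) := by
  have h := Finset.prod_univ_sum (fun _ : Fin n => (Finset.univ : Finset Bool))
    (fun i c => Real.exp (l * (if c then v i else -v i)))
  rw [Fintype.piFinset_univ] at h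
  simp_rw [Finset.mul_sum, Real.exp_sum]
  rw [← h]
  simp only [Fintype.sum_bool]
  rw [show (2 : ℝ) ^ n = ∏ _i : Fin n, (2 : ℝ) by simp, ← Finset.prod_mul_distrib]
  refine Finset.prod_congr rfl fun i _ => ?_
  rw [Real.cosh_eq]
  simp
  ring

open Classical in
-- Chernoff's method: the indicator of `|s| > u` is at most `exp (-lu) (exp (ls) + exp (-ls))`, and
-- both terms have the same sum over the signs. The majorants `c i` leave room for a bound common to
-- all vectors of a class.
theorem card_signs_abs_sum_gt_le {n : ℕ} (v c : Fin n → ℝ) {l : ℝ} (hl : 0 ≤ l) (u : ℝ)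
    (hc : ∀ i, Real.cosh (l * v i) ≤ c i) :
    ((Finset.univ.filter fun b : Fin n → Bool =>
      u < |∑ i, (if b i then v i else -v i)|).card : ℝ) ≤
      2 * Real.exp (-(l * u)) * (2 ^ n * ∏ i, c i) := by
  have hprod : ∏ i, Real.cosh (l * v i) ≤ ∏ i, c i :=
    Finset.prod_le_prod (fun i _ => (Real.cosh_pos _).le) fun i _ => hc i
  have h1 := sum_exp_signed_sum v l
  have h2 : ∑ b : Fin n → Bool, Real.exp (-(l * ∑ i, (if b i then v i else -v i))) =
      2 ^ n * ∏ i, Real.cosh (l * v i) := by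
    rw [← (by simp [Real.cosh_neg] : ∏ i, Real.cosh (-l * v i) = ∏ i, Real.cosh (l * v i)),
      ← sum_exp_signed_sum v (-l)]
    simp
  calc ((Finset.univ.filter fun b : Fin n → Bool =>
        u < |∑ i, (if b i then v i else -v i)|).card : ℝ)
      = ∑ b : Fin n → Bool, if u < |∑ i, (if b i then v i else -v i)| then (1 : ℝ) else 0 := by
        simp
    _ ≤ ∑ b : Fin n → Bool, Real.exp (-(l * u)) *
        (Real.exp (l * ∑ i, (if b i then v i else -v i)) +
          Real.exp (-(l * ∑ i, (if b i then v i else -v i)))) := by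
        refine Finset.sum_le_sum fun b _ => ?_
        generalize ∑ i, (if b i then v i else -v i) = s
        split_ifs with h
        · rw [mul_add, ← Real.exp_add, ← Real.exp_add]
          rcases lt_abs.1 h with h | h
          · have : 1 ≤ Real.exp (-(l * u) + l * s) := Real.one_le_exp (by nlinarith)
            linarith [Real.exp_pos (-(l * u) + -(l * s))]
          · have : 1 ≤ Real.exp (-(l * u) + -(l * s)) := Real.one_le_exp (by nlinarith)
            linarith [Real.exp_pos (-(l * u) + l * s)]
        · positivity
    _ = 2 * Real.exp (-(l * u)) * (2 ^ n * ∏ i, Real.cosh (l * v i)) := by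
        rw [← Finset.mul_sum, Finset.sum_add_distrib, h1, h2]
        ring
    _ ≤ _ := by gcongr

open Classical in
theorem card_signs_exists_abs_sum_gt_le {n : ℕ} {T : Set (Fin n → ℝ)} (hT : T.Finite)
    (c : Fin n → ℝ) {l : ℝ} (hl : 0 ≤ l) (u : ℝ)
    (hc : ∀ v ∈ T, ∀ i, Real.cosh (l * v i) ≤ c i) :
    ((Finset.univ.filter fun b : Fin n → Bool =>
      ∃ v ∈ T, u < |∑ i, (if b i then v i else -v i)|).card : ℝ) ≤
      T.ncard * (2 * Real.exp (-(l * u)) * (2 ^ n * ∏ i, c i)) := by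
  have hsub : (Finset.univ.filter fun b : Fin n → Bool =>
      ∃ v ∈ T, u < |∑ i, (if b i then v i else -v i)|) ⊆
      hT.toFinset.biUnion fun v => Finset.univ.filter fun b : Fin n → Bool =>
        u < |∑ i, (if b i then v i else -v i)| := by
    intro b
    simp
  calc _ ≤ ((∑ v ∈ hT.toFinset, (Finset.univ.filter fun b : Fin n → Bool =>
        u < |∑ i, (if b i then v i else -v i)|).card : ℕ) : ℝ) := by
        exact_mod_cast (Finset.card_le_card hsub).trans Finset.card_biUnion_le
    _ ≤ ∑ v ∈ hT.toFinset, 2 * Real.exp (-(l * u)) * (2 ^ n * ∏ i, c i) := by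
        push_cast
        exact Finset.sum_le_sum fun v hv =>
          card_signs_abs_sum_gt_le v c hl u (hc v (hT.mem_toFinset.1 hv))
    _ = _ := by
        rw [Finset.sum_const, nsmul_eq_mul, Set.ncard_eq_toFinset_card T hT]

end Rademacher

/-! ### Numerical bounds that fix the constants. -/

section Numeric

theorem cosh_sub_one_le {u : ℝ} (h0 : 0 ≤ u) (h1 : u ≤ 3 / 4) :
    Real.cosh u - 1 ≤ 5 / 9 * u ^ 2 := by
  have h2 := Real.cosh_sq' (u / 2)
  have h3 := Real.cosh_two_mul (u / 2)
  rw [mul_div_cancel₀ u two_ne_zero] at h3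
  -- As `cosh u - 1 = 2 sinh² (u/2)`, the factor `21/20` suffices: `(21/20)² / 2 < 5/9`.
  have h4 : Real.sinh (u / 2) ≤ (u / 2) * (21 / 20) := by
    rw [Real.sinh_eq]
    have := Real.exp_bound' (x := u / 2) (by linarith) (by linarith) (n := 5) (by norm_num)
    have h5 := Real.exp_bound (x := -(u / 2)) (by rw [abs_neg, abs_of_nonneg] <;> linarith)
      (n := 5) (by norm_num)
    have h6 := (abs_le.1 h5).1
    simp only [abs_neg, abs_of_nonneg (by linarith : 0 ≤ u / 2)] at h6
    simp [Finset.sum_range_succ, Nat.factorial] at this h6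
    have h7 : u ^ 3 ≤ u * (9 / 16) := by nlinarith
    have h8 : u ^ 5 ≤ u * (81 / 256) := by nlinarith [mul_nonneg h0 (sq_nonneg u)]
    nlinarith
  have h9 : 0 ≤ Real.sinh (u / 2) := Real.sinh_nonneg_iff.2 (by linarith)
  nlinarith

theorem log_twelve_ge : (12 / 5 : ℝ) ≤ Real.log 12 := by
  have : Real.exp (12 / 5 : ℝ) ≤ 12 := by
    have h := Real.exp_one_lt_d9
    calc Real.exp (12 / 5 : ℝ) = (Real.exp 1 ^ 12) ^ (1 / 5 : ℝ) := by
          rw [← Real.exp_nat_mul, ← Real.exp_mul]; norm_num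
      _ ≤ ((12 : ℝ) ^ 5) ^ (1 / 5 : ℝ) := by
          refine Real.rpow_le_rpow (by positivity) ?_ (by norm_num)
          calc Real.exp 1 ^ 12 ≤ (2.7182818286 : ℝ) ^ 12 := by gcongr
            _ ≤ _ := by norm_num
      _ = 12 := by
          rw [← Real.rpow_natCast, ← Real.rpow_mul (by norm_num)]; norm_num
  exact (Real.le_log_iff_exp_le (by norm_num)).2 this

end Numeric

/-! ### Ghost sample, exchange of pairs and the tail of the symmetrized deviation. -/

section Symmetrization

variable {E : Type*} [MeasurableSpace E]

/-- Symmetrization by a ghost sample. -/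
theorem mul_measureReal_exists_abs_sub_gt_le {α : Type*} [MeasurableSpace α] (ν : Measure α)
    [IsProbabilityMeasure ν] (f : ℕ → α → ℝ) (m : ℕ → ℝ) {c s t : ℝ} (hc : 0 ≤ c)
    (hf : ∀ k, Measurable (f k)) (h : ∀ k, c ≤ ν.real {y | |f k y - m k| < t - s}) :
    c * ν.real {x | ∃ k, t < |f k x - m k|} ≤
      (ν.prod ν).real {w | ∃ k, s < |f k w.1 - f k w.2|} := by
  have hbad : MeasurableSet {x | ∃ k, t < |f k x - m k|} := by
    rw [Set.ofPred_exists]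
    exact .iUnion fun k => measurableSet_lt measurable_const
      (continuous_abs.measurable.comp ((hf k).sub_const _))
  have hS : MeasurableSet {w : α × α | ∃ k, s < |f k w.1 - f k w.2|} := by
    rw [Set.ofPred_exists]
    exact .iUnion fun k => measurableSet_lt measurable_const
      (continuous_abs.measurable.comp
        (((hf k).comp measurable_fst).sub ((hf k).comp measurable_snd)))
  have key : ENNReal.ofReal c * ν {x | ∃ k, t < |f k x - m k|} ≤
      (ν.prod ν) {w | ∃ k, s < |f k w.1 - f k w.2|} := by
    rw [Measure.prod_apply hS, ← lintegral_indicator_const hbad]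
    refine lintegral_mono fun x => ?_
    by_cases hx : x ∈ {x | ∃ k, t < |f k x - m k|}
    · rw [Set.indicator_of_mem hx]
      obtain ⟨k, hk⟩ := hx
      -- The index `k` may depend on `x`: the section at `x` contains the good event for that `k`,
      -- whose mass is at least `c`, so no measurable selection is needed.
      refine ((ENNReal.ofReal_le_ofReal (h k)).trans_eq (ofReal_measureReal)).trans
        (measure_mono fun y hy => ⟨k, ?_⟩)
      have h1 := abs_sub_abs_le_abs_sub (f k x - m k) (f k y - m k)
      rw [sub_sub_sub_cancel_right] at h1
      have h2 : |f k y - m k| < t - s := hy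
      change s < |f k x - f k y|
      linarith
    · rw [Set.indicator_of_notMem hx]
      exact zero_le
  have := ENNReal.toReal_mono (measure_ne_top _ _) key
  rwa [ENNReal.toReal_mul, ENNReal.toReal_ofReal hc] at this

/-- The map that exchanges the two members of the pairs `z i` with `b i = false`. -/
def swapPairs {n : ℕ} (b : Fin n → Bool) (z : Fin n → E × E) (i : Fin n) : E × E :=
  if b i then z i else (z i).swap

theorem measurePreserving_swapPairs {n : ℕ} (μ : Measure E) [IsProbabilityMeasure μ]
    (b : Fin n → Bool) :
    MeasurePreserving (swapPairs (E := E) b) (Measure.pi fun _ => μ.prod μ)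
      (Measure.pi fun _ => μ.prod μ) := by
  refine measurePreserving_pi (fun _ => μ.prod μ) (fun _ => μ.prod μ)
    (f := fun i w => if b i then w else w.swap) fun i => ?_
  cases b i
  · simpa using Measure.measurePreserving_swap
  · exact MeasurePreserving.id _

omit [MeasurableSpace E] in
theorem indicatorDiff_swapPairs {n : ℕ} (b : Fin n → Bool) (z : Fin n → E × E) (A : Set E)
    (i : Fin n) : indicatorDiff (swapPairs b z) A i =
      if b i then indicatorDiff z A i else -indicatorDiff z A i := by
  unfold indicatorDiff swapPairs
  split_ifs <;> simp

theorem measurable_indicatorDiff {n : ℕ} {A : Set E} (hA : MeasurableSet A) (i : Fin n) :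
    Measurable fun z : Fin n → E × E => indicatorDiff z A i := by
  have h : Measurable (A.indicator (fun _ => (1 : ℝ))) := measurable_const.indicator hA
  unfold indicatorDiff
  exact (h.comp (measurable_fst.comp (measurable_pi_apply i))).sub
    (h.comp (measurable_snd.comp (measurable_pi_apply i)))

theorem integrable_indicator_fst_add_snd (μ : Measure E) [IsProbabilityMeasure μ]
    {𝔸 : Set E} (h𝔸 : MeasurableSet 𝔸) (r : ℝ) :
    Integrable (fun w : E × E => 1 + r * (𝔸.indicator (fun _ => (1 : ℝ)) w.1 +
      𝔸.indicator (fun _ => (1 : ℝ)) w.2)) (μ.prod μ) := by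
  have h : Integrable (𝔸.indicator (fun _ => (1 : ℝ))) μ := (integrable_const 1).indicator h𝔸
  exact (integrable_const 1).add (((h.comp_fst μ).add (h.comp_snd μ)).const_mul r)

theorem integral_indicator_fst_add_snd (μ : Measure E) [IsProbabilityMeasure μ]
    {𝔸 : Set E} (h𝔸 : MeasurableSet 𝔸) (r : ℝ) :
    ∫ w : E × E, 1 + r * (𝔸.indicator (fun _ => (1 : ℝ)) w.1 +
      𝔸.indicator (fun _ => (1 : ℝ)) w.2) ∂(μ.prod μ) = 1 + r * (2 * μ.real 𝔸) := by
  have h : Integrable (𝔸.indicator (fun _ => (1 : ℝ))) μ := (integrable_const 1).indicator h𝔸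
  have h0 : ∫ x, 𝔸.indicator (fun _ => (1 : ℝ)) x ∂μ = μ.real 𝔸 :=
    integral_indicator_one h𝔸
  have h1 : Integrable (fun w : E × E => r * (𝔸.indicator (fun _ => (1 : ℝ)) w.1 +
      𝔸.indicator (fun _ => (1 : ℝ)) w.2)) (μ.prod μ) :=
    ((h.comp_fst μ).add (h.comp_snd μ)).const_mul r
  rw [integral_add (integrable_const 1) h1, integral_const_mul, integral_add (h.comp_fst μ) (h.comp_snd μ),
    integral_fun_fst, integral_fun_snd, h0]
  simp
  ring_nf
  simp

theorem measureReal_exists_abs_sum_indicatorDiff_gt_le {n : ℕ} (μ : Measure E)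
    [IsProbabilityMeasure μ] {𝒜 : Set (Set E)} {𝔸 : Set E} (h𝔸 : MeasurableSet 𝔸)
    (A : ℕ → Set E) (hA : ∀ k, A k ∈ 𝒜) (hAm : ∀ k, MeasurableSet (A k)) (hA𝔸 : ∀ k, A k ⊆ 𝔸)
    {l : ℝ} (hl : 0 ≤ l) (u : ℝ) :
    (Measure.pi fun _ : Fin n => μ.prod μ).real {z | ∃ k, u < |∑ i, indicatorDiff z (A k) i|} ≤
      2 * shatterCoeff 𝒜 (2 * n) *
        Real.exp (2 * n * μ.real 𝔸 * (Real.cosh l - 1) - l * u) := by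
  classical
  set π := Measure.pi fun _ : Fin n => μ.prod μ with hπ
  set F : Set (Fin n → E × E) := {z | ∃ k, u < |∑ i, indicatorDiff z (A k) i|} with hFdef
  have hF : MeasurableSet F := by
    rw [hFdef, Set.ofPred_exists]
    exact .iUnion fun k => measurableSet_lt measurable_const (continuous_abs.measurable.comp
      (Finset.measurable_sum _ fun i _ => measurable_indicatorDiff (hAm k) i))
  have hr : 0 ≤ Real.cosh l - 1 := sub_nonneg.2 (Real.one_le_cosh l)
  -- This majorant of `cosh (l vᵢ)` does not depend on `k`, and it is integrable with mean `1 + 2p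
  -- (cosh l - 1)`.
  set c : E × E → ℝ := fun w => 1 + (Real.cosh l - 1) *
    (𝔸.indicator (fun _ => (1 : ℝ)) w.1 + 𝔸.indicator (fun _ => (1 : ℝ)) w.2) with hcdef
  have hind (x : E) : 0 ≤ 𝔸.indicator (fun _ => (1 : ℝ)) x :=
    Set.indicator_nonneg (fun _ _ => zero_le_one) x
  have hc1 (w : E × E) : 1 ≤ c w := by
    have := mul_nonneg hr (add_nonneg (hind w.1) (hind w.2))
    simp only [hcdef]
    linarith
  have hcosh (z : Fin n → E × E) (k : ℕ) (i : Fin n) :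
      Real.cosh (l * indicatorDiff z (A k) i) ≤ c (z i) := by
    by_cases hz : (z i).1 ∈ 𝔸 ∨ (z i).2 ∈ 𝔸
    · have h1 : Real.cosh (l * indicatorDiff z (A k) i) ≤ Real.cosh l := by
        rw [Real.cosh_le_cosh, abs_mul]
        exact mul_le_of_le_one_right (abs_nonneg l) (abs_indicatorDiff_le z (A k) i)
      have h2 : 1 ≤ 𝔸.indicator (fun _ => (1 : ℝ)) (z i).1 +
          𝔸.indicator (fun _ => (1 : ℝ)) (z i).2 := by
        rcases hz with hz | hz
        · rw [Set.indicator_of_mem hz]; linarith [hind (z i).2]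
        · rw [Set.indicator_of_mem hz]; linarith [hind (z i).1]
      simp only [hcdef]
      nlinarith
    · rw [not_or] at hz
      have h1 : indicatorDiff z (A k) i = 0 := by
        unfold indicatorDiff
        rw [Set.indicator_of_notMem fun h => hz.1 (hA𝔸 k h),
          Set.indicator_of_notMem fun h => hz.2 (hA𝔸 k h), sub_zero]
      rw [h1, mul_zero, Real.cosh_zero]
      exact hc1 _
  -- For fixed pairs, the swaps that land in `F` are the sign patterns with a large signed sum.
  have hpt (z : Fin n → E × E) :
      ∑ b : Fin n → Bool, F.indicator (fun _ => (1 : ℝ)) (swapPairs b z) ≤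
        (shatterCoeff 𝒜 (2 * n) * (2 * Real.exp (-(l * u)) * 2 ^ n)) * ∏ i, c (z i) := by
    obtain ⟨hfin, hcard⟩ := indicatorDiff_image_finite_and_ncard_le 𝒜 z
    have hsub : indicatorDiff z '' Set.range A ⊆ indicatorDiff z '' 𝒜 := by
      refine Set.image_mono ?_
      rintro _ ⟨k, rfl⟩
      exact hA k
    have hcount := card_signs_exists_abs_sum_gt_le (hfin.subset hsub) (fun i => c (z i)) hl u
      (by rintro _ ⟨_, ⟨k, rfl⟩, rfl⟩ i; exact hcosh z k i)
    have hprod : 0 ≤ ∏ i, c (z i) :=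
      Finset.prod_nonneg fun i _ => zero_le_one.trans (hc1 (z i))
    calc ∑ b : Fin n → Bool, F.indicator (fun _ => (1 : ℝ)) (swapPairs b z)
        = ((Finset.univ.filter fun b : Fin n → Bool => ∃ v ∈ indicatorDiff z '' Set.range A,
            u < |∑ i, (if b i then v i else -v i)|).card : ℝ) := by
          rw [Finset.card_filter]
          push_cast
          refine Finset.sum_congr rfl fun b _ => ?_
          simp [Set.indicator, hFdef, indicatorDiff_swapPairs]
      _ ≤ _ := hcount
      _ ≤ shatterCoeff 𝒜 (2 * n) * (2 * Real.exp (-(l * u)) * (2 ^ n * ∏ i, c (z i))) := by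
          gcongr
          exact (Set.ncard_le_ncard hsub hfin).trans hcard
      _ = _ := by ring
  have hswap (b : Fin n → Bool) : Integrable
      (fun z => F.indicator (fun _ => (1 : ℝ)) (swapPairs b z)) π :=
    (measurePreserving_swapPairs μ b).integrable_comp_of_integrable
      ((integrable_const 1).indicator hF)
  have hswap' (b : Fin n → Bool) :
      ∫ z, F.indicator (fun _ => (1 : ℝ)) (swapPairs b z) ∂π = π.real F := by
    have h0 : ∫ z, F.indicator (fun _ => (1 : ℝ)) z ∂π = π.real F :=
      integral_indicator_one hF
    have hmp := measurePreserving_swapPairs μ b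
    rw [← h0]
    conv_rhs => rw [hπ, ← hmp.map_eq]
    rw [integral_map hmp.measurable.aemeasurable
      (measurable_const.indicator hF).aestronglyMeasurable]
  have hcint : Integrable (fun z : Fin n → E × E => ∏ i, c (z i)) π :=
    Integrable.fintype_prod fun _ => integrable_indicator_fst_add_snd μ h𝔸 _
  have hcval : ∫ z : Fin n → E × E, ∏ i, c (z i) ∂π =
      (1 + (Real.cosh l - 1) * (2 * μ.real 𝔸)) ^ n := by
    rw [hπ, integral_fintype_prod_eq_pow, integral_indicator_fst_add_snd μ h𝔸, Fintype.card_fin]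
  -- Each of the `2 ^ n` swaps preserves `π`, so integrating the pointwise count gives `2 ^ n`
  -- copies of `π.real F`.
  have hmain : 2 ^ n * π.real F ≤ (shatterCoeff 𝒜 (2 * n) * (2 * Real.exp (-(l * u)) * 2 ^ n)) *
      (1 + (Real.cosh l - 1) * (2 * μ.real 𝔸)) ^ n := by
    calc 2 ^ n * π.real F
        = ∫ z, ∑ b : Fin n → Bool, F.indicator (fun _ => (1 : ℝ)) (swapPairs b z) ∂π := by
          rw [integral_finsetSum _ fun b _ => hswap b]
          simp [hswap']
      _ ≤ ∫ z, (shatterCoeff 𝒜 (2 * n) * (2 * Real.exp (-(l * u)) * 2 ^ n)) * ∏ i, c (z i) ∂π :=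
          integral_mono (integrable_finsetSum _ fun b _ => hswap b) (hcint.const_mul _) hpt
      _ = _ := by rw [integral_const_mul, hcval]
  have hexp : (1 + (Real.cosh l - 1) * (2 * μ.real 𝔸)) ^ n ≤
      Real.exp (2 * n * μ.real 𝔸 * (Real.cosh l - 1)) := by
    have h1 : 1 + (Real.cosh l - 1) * (2 * μ.real 𝔸) ≤
        Real.exp ((Real.cosh l - 1) * (2 * μ.real 𝔸)) := by
      rw [add_comm]; exact Real.add_one_le_exp _
    have h2 : 0 ≤ 1 + (Real.cosh l - 1) * (2 * μ.real 𝔸) := by positivity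
    refine (pow_le_pow_left₀ h2 h1 n).trans_eq ?_
    rw [← Real.exp_nat_mul]
    ring_nf
  have h2n : (0 : ℝ) < 2 ^ n := by positivity
  refine le_of_mul_le_mul_left ?_ h2n
  calc 2 ^ n * π.real F ≤ _ := hmain
    _ ≤ (shatterCoeff 𝒜 (2 * n) * (2 * Real.exp (-(l * u)) * 2 ^ n)) *
        Real.exp (2 * n * μ.real 𝔸 * (Real.cosh l - 1)) := by gcongr
    _ = _ := by rw [sub_eq_add_neg _ (l * u), Real.exp_add]; ring

end Symmetrization

/-! ### Measurability and reduction to a sequence of sets. -/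

section Empirical

variable {E : Type*} [MeasurableSpace E]

theorem empiricalMeasure_real_eq {n : ℕ} (x : Fin n → E) {A : Set E} (hA : MeasurableSet A) :
    (empiricalMeasure x).real A = ∑ i, A.indicator (fun _ => (1 : ℝ)) (x i) / n := by
  rw [empiricalMeasure, measureReal_ennreal_smul_apply, measureReal_def,
    Measure.finsetSum_apply, ENNReal.toReal_sum fun i _ => measure_ne_top _ _, Finset.mul_sum]
  refine Finset.sum_congr rfl fun i _ => ?_
  rw [Measure.dirac_apply' _ hA, ENNReal.toReal_inv, ENNReal.toReal_natCast, div_eq_inv_mul]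
  by_cases h : x i ∈ A <;> simp [h]

instance isFiniteMeasure_empiricalMeasure {n : ℕ} (x : Fin n → E) :
    IsFiniteMeasure (empiricalMeasure x) := by
  refine ⟨?_⟩
  rcases Nat.eq_zero_or_pos n with rfl | hn
  -- For `n = 0` the factor `n⁻¹` is `∞`, but it multiplies an empty sum, so the measure is zero.
  · simp [empiricalMeasure]
  · have : (n : ENNReal) ≠ 0 := by exact_mod_cast hn.ne'
    rw [empiricalMeasure, Measure.smul_apply, smul_eq_mul]
    exact ENNReal.mul_lt_top (by simpa [ENNReal.inv_lt_top, pos_iff_ne_zero] using this)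
      (measure_lt_top _ _)

theorem measurable_empiricalMeasure_real {n : ℕ} {A : Set E} (hA : MeasurableSet A) :
    Measurable fun x : Fin n → E => (empiricalMeasure x).real A := by
  simp_rw [empiricalMeasure_real_eq _ hA]
  exact Finset.measurable_sum _ fun i _ =>
    ((measurable_const.indicator hA).comp (measurable_pi_apply i)).div_const _

theorem abs_sub_real_le (ρ ν : Measure E) [IsFiniteMeasure ρ] [IsFiniteMeasure ν] (A : Set E) :
    |ρ.real A - ν.real A| ≤ max (ρ.real Set.univ) (ν.real Set.univ) := by
  have h1 := measureReal_mono (μ := ρ) (Set.subset_univ A)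
  have h2 := measureReal_mono (μ := ν) (Set.subset_univ A)
  have h3 : 0 ≤ ρ.real A := measureReal_nonneg
  have h4 : 0 ≤ ν.real A := measureReal_nonneg
  rw [abs_le]
  constructor
  · linarith [le_max_right (ρ.real Set.univ) (ν.real Set.univ)]
  · linarith [le_max_left (ρ.real Set.univ) (ν.real Set.univ)]

omit [MeasurableSpace E] in
theorem PointwiseMeasurable.exists_seq {𝒜 : Set (Set E)} (h : PointwiseMeasurable 𝒜)
    (hne : 𝒜.Nonempty) : ∃ A : ℕ → Set E, (∀ k, A k ∈ 𝒜) ∧ ∀ B ∈ 𝒜, ∃ φ : ℕ → ℕ,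
      ∀ x, ∀ᶠ k in atTop, x ∈ A (φ k) ↔ x ∈ B := by
  obtain ⟨𝒜₀, hsub, hcount, happ⟩ := h
  obtain ⟨B₀, hB₀⟩ := hne
  obtain ⟨C, hC, -⟩ := happ B₀ hB₀
  obtain ⟨A, rfl⟩ := hcount.exists_eq_range ⟨C 0, hC 0⟩
  refine ⟨A, fun k => hsub ⟨k, rfl⟩, fun B hB => ?_⟩
  obtain ⟨D, hD, hlim⟩ := happ B hB
  choose φ hφ using hD
  refine ⟨φ, fun x => ?_⟩
  have := (tendsto_indicator_const_apply_iff_eventually (L := atTop) (As := D) (A := B) (1 : ℝ) x).1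
    (hlim x)
  simpa only [hφ] using this

/-- Pointwise convergence of indicators passes to the values of both finite measures, so each
deviation is a limit of deviations along the sequence. -/
theorem maxDeviation_eq_iSup (μ : Measure E) [IsFiniteMeasure μ] {𝒜 : Set (Set E)}
    {A : ℕ → Set E} (hA : ∀ k, A k ∈ 𝒜) (hAm : ∀ k, MeasurableSet (A k))
    (hlim : ∀ B ∈ 𝒜, ∃ φ : ℕ → ℕ, ∀ x, ∀ᶠ k in atTop, x ∈ A (φ k) ↔ x ∈ B) {n : ℕ}
    (x : Fin n → E) :
    maxDeviation μ 𝒜 x = ⨆ k, |(empiricalMeasure x).real (A k) - μ.real (A k)| := by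
  have : Nonempty 𝒜 := ⟨⟨A 0, hA 0⟩⟩
  refine le_antisymm (ciSup_le fun ⟨B, hB⟩ => ?_) (ciSup_le fun k => ?_)
  · obtain ⟨φ, hφ⟩ := hlim B hB
    have hconv (ν : Measure E) [IsFiniteMeasure ν] :
        Tendsto (fun k => ν.real (A (φ k))) atTop (𝓝 (ν.real B)) :=
      (ENNReal.tendsto_toReal (measure_ne_top _ _)).comp
        (tendsto_measure_of_tendsto_indicator_of_isFiniteMeasure atTop ν (fun k => hAm (φ k)) hφ)
    refine le_of_tendsto ((hconv (empiricalMeasure x)).sub (hconv μ)).abs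
      (Eventually.of_forall fun k => ?_)
    refine le_ciSup (f := fun k => |(empiricalMeasure x).real (A k) - μ.real (A k)|)
      ⟨max ((empiricalMeasure x).real Set.univ) (μ.real Set.univ), ?_⟩ (φ k)
    rintro _ ⟨k, rfl⟩
    exact abs_sub_real_le _ _ _
  · refine le_ciSup (f := fun B : 𝒜 =>
      |(empiricalMeasure x).real (B : Set E) - μ.real (B : Set E)|)
      ⟨max ((empiricalMeasure x).real Set.univ) (μ.real Set.univ), ?_⟩ ⟨A k, hA k⟩
    rintro _ ⟨B, rfl⟩
    exact abs_sub_real_le _ _ _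

theorem iSup_abs_sub_real_le_iff (ρ ν : Measure E) [IsFiniteMeasure ρ] [IsFiniteMeasure ν]
    (A : ℕ → Set E) (t : ℝ) :
    (⨆ k, |ρ.real (A k) - ν.real (A k)|) ≤ t ↔ ∀ k, |ρ.real (A k) - ν.real (A k)| ≤ t := by
  refine ciSup_le_iff ⟨max (ρ.real Set.univ) (ν.real Set.univ), ?_⟩
  rintro _ ⟨k, rfl⟩
  exact abs_sub_real_le _ _ _

end Empirical

/-! ### Chernoff and Chebyshev bounds, and the choice of constants. -/

section Tails

variable {E : Type*} [MeasurableSpace E]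

/-- A Chernoff bound for the number of sample points in a set. -/
theorem measureReal_two_mul_lt_empiricalMeasure_le {n : ℕ} (hn : 0 < n) (μ : Measure E)
    [IsProbabilityMeasure μ] {𝔸 : Set E} (h𝔸 : MeasurableSet 𝔸) :
    (Measure.pi fun _ : Fin n => μ).real {x | 2 * μ.real 𝔸 < (empiricalMeasure x).real 𝔸} ≤
      Real.exp (-(3 / 8 * (n * μ.real 𝔸))) := by
  set p := μ.real 𝔸 with hp
  have hp0 : 0 ≤ p := measureReal_nonneg
  have hn' : (0 : ℝ) < n := by exact_mod_cast hn
  set ν := Measure.pi fun _ : Fin n => μ with hν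
  have hi : Integrable (𝔸.indicator (fun _ => (1 : ℝ))) μ := (integrable_const 1).indicator h𝔸
  have h0 : ∫ x, 𝔸.indicator (fun _ => (1 : ℝ)) x ∂μ = p := integral_indicator_one h𝔸
  have hint : Integrable (fun x : Fin n → E => ∏ i, (1 + 𝔸.indicator (fun _ => (1 : ℝ)) (x i))) ν :=
    Integrable.fintype_prod (f := fun _ : Fin n => fun y => 1 + 𝔸.indicator (fun _ => (1 : ℝ)) y)
      fun _ => (integrable_const 1).add hi
  have hval : ∫ x : Fin n → E, ∏ i, (1 + 𝔸.indicator (fun _ => (1 : ℝ)) (x i)) ∂ν =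
      (1 + p) ^ n := by
    rw [hν, integral_fintype_prod_eq_pow (fun y => 1 + 𝔸.indicator (fun _ => (1 : ℝ)) y),
      integral_add (integrable_const 1) hi, h0, Fintype.card_fin]
    simp
  -- The product is `2 ^ N`, with `N` the number of sample points in 𝔸; Markov's inequality is
  -- applied to it at the level `2 ^ (2np)`.
  have hexp (x : Fin n → E) : ∏ i, (1 + 𝔸.indicator (fun _ => (1 : ℝ)) (x i)) =
      Real.exp (Real.log 2 * (n * (empiricalMeasure x).real 𝔸)) := by
    rw [empiricalMeasure_real_eq x h𝔸, ← Finset.sum_div, mul_div_cancel₀ _ hn'.ne',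
      Finset.mul_sum, Real.exp_sum]
    refine Finset.prod_congr rfl fun i _ => ?_
    by_cases h : x i ∈ 𝔸
    · simp [h, Real.exp_log]; norm_num
    · simp [h]
  have hmarkov := mul_meas_ge_le_integral_of_nonneg (μ := ν)
    (f := fun x : Fin n → E => ∏ i, (1 + 𝔸.indicator (fun _ => (1 : ℝ)) (x i)))
    (Eventually.of_forall fun x => by simp only [hexp]; positivity) hint
    (Real.exp (Real.log 2 * (n * (2 * p))))
  have hsub : ν.real {x | 2 * p < (empiricalMeasure x).real 𝔸} ≤
      ν.real {x | Real.exp (Real.log 2 * (n * (2 * p))) ≤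
        ∏ i, (1 + 𝔸.indicator (fun _ => (1 : ℝ)) (x i))} := by
    refine measureReal_mono fun x hx => ?_
    change Real.exp _ ≤ _
    rw [hexp]
    have : 2 * p < (empiricalMeasure x).real 𝔸 := hx
    gcongr
  have hpow : (1 + p) ^ n ≤ Real.exp (n * p) := by
    rw [Real.exp_nat_mul]
    gcongr
    rw [add_comm]
    exact Real.add_one_le_exp p
  refine le_of_mul_le_mul_left ?_ (Real.exp_pos (Real.log 2 * (n * (2 * p))))
  calc _ ≤ _ := mul_le_mul_of_nonneg_left hsub (Real.exp_pos _).le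
    _ ≤ (1 + p) ^ n := hmarkov.trans_eq hval
    _ ≤ Real.exp (n * p) := hpow
    _ ≤ _ := by
      rw [← Real.exp_add, Real.exp_le_exp]
      -- What remains is `1 - 2 log 2 ≤ -3/8`.
      have := Real.log_two_gt_d9
      have hnp : 0 ≤ n * p := by positivity
      nlinarith

theorem integral_empiricalMeasure_real {n : ℕ} (hn : 0 < n) (μ : Measure E)
    [IsProbabilityMeasure μ] {A : Set E} (hA : MeasurableSet A) :
    ∫ x, (empiricalMeasure x).real A ∂(Measure.pi fun _ : Fin n => μ) = μ.real A := by
  have hi : Integrable (fun y => A.indicator (fun _ => (1 : ℝ)) y / n) μ :=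
    ((integrable_const 1).indicator hA).div_const _
  have hn' : (n : ℝ) ≠ 0 := by exact_mod_cast hn.ne'
  have h0 : ∫ x, A.indicator (fun _ => (1 : ℝ)) x ∂μ = μ.real A := integral_indicator_one hA
  simp_rw [empiricalMeasure_real_eq _ hA]
  rw [integral_finsetSum _ fun i _ => integrable_comp_eval (μ := fun _ : Fin n => μ) (i := i) hi]
  have (i : Fin n) : ∫ x : Fin n → E, A.indicator (fun _ => (1 : ℝ)) (x i) / n
      ∂(Measure.pi fun _ : Fin n => μ) = μ.real A / n := by
    rw [integral_comp_eval (μ := fun _ : Fin n => μ) (i := i)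
      (f := fun y => A.indicator (fun _ => (1 : ℝ)) y / n) hi.aestronglyMeasurable,
      integral_div, h0]
  simp [this, mul_div_cancel₀ _ hn']

theorem memLp_indicator_div (μ : Measure E) [IsProbabilityMeasure μ] {A : Set E}
    (hA : MeasurableSet A) (c : ℝ) :
    MemLp (fun y => A.indicator (fun _ => (1 : ℝ)) y / c) 2 μ := by
  have := (memLp_indicator_const 2 hA (1 : ℝ) (Or.inr (measure_ne_top μ A))).const_mul c⁻¹
  simpa only [div_eq_inv_mul] using this

theorem variance_empiricalMeasure_real_le {n : ℕ} (hn : 0 < n) (μ : Measure E)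
    [IsProbabilityMeasure μ] {A : Set E} (hA : MeasurableSet A) :
    Var[fun x => (empiricalMeasure x).real A; Measure.pi fun _ : Fin n => μ] ≤ μ.real A / n := by
  have hn' : (n : ℝ) ≠ 0 := by exact_mod_cast hn.ne'
  have hL := memLp_indicator_div μ hA n
  have heq : (fun x : Fin n → E => (empiricalMeasure x).real A) =
      ∑ i : Fin n, fun x : Fin n → E => A.indicator (fun _ => (1 : ℝ)) (x i) / n := by
    ext x
    rw [empiricalMeasure_real_eq x hA, Finset.sum_apply]
  have hvar : Var[fun y => A.indicator (fun _ => (1 : ℝ)) y / n; μ] ≤ μ.real A / n ^ 2 := by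
    refine (variance_le_expectation_sq hL.aestronglyMeasurable).trans_eq ?_
    have : ((fun y => A.indicator (fun _ => (1 : ℝ)) y / n) ^ 2 : E → ℝ) =
        fun y => A.indicator (fun _ => (1 : ℝ)) y / n ^ 2 := by
      ext y
      by_cases h : y ∈ A <;> simp [h]
    rw [this, integral_div]
    congr 1
    exact integral_indicator_one hA
  rw [heq, variance_sum_pi (X := fun _ : Fin n => fun y => A.indicator (fun _ => (1 : ℝ)) y / n)
    fun _ => hL]
  calc _ ≤ ∑ _i : Fin n, μ.real A / n ^ 2 := Finset.sum_le_sum fun _ _ => hvar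
    _ = μ.real A / n := by
      rw [Finset.sum_const, Finset.card_univ, Fintype.card_fin, nsmul_eq_mul]
      field_simp

theorem measureReal_abs_empiricalMeasure_sub_lt_ge {n : ℕ} (hn : 0 < n) (μ : Measure E)
    [IsProbabilityMeasure μ] {A : Set E} (hA : MeasurableSet A) {s : ℝ} (hs : 0 < s) :
    1 - μ.real A / (n * s ^ 2) ≤ (Measure.pi fun _ : Fin n => μ).real
      {x | |(empiricalMeasure x).real A - μ.real A| < s} := by
  set ν := Measure.pi fun _ : Fin n => μ with hν
  have hL : MemLp (fun x : Fin n → E => (empiricalMeasure x).real A) 2 ν := by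
    have := memLp_finsetSum (p := 2) (μ := ν) (Finset.univ : Finset (Fin n))
      (f := fun i => fun x : Fin n → E => A.indicator (fun _ => (1 : ℝ)) (x i) / n)
      fun i _ => (memLp_indicator_div μ hA n).comp_measurePreserving (measurePreserving_eval _ i)
    simpa only [empiricalMeasure_real_eq _ hA] using this
  have hch := meas_ge_le_variance_div_sq hL hs
  rw [integral_empiricalMeasure_real hn μ hA] at hch
  have hms : MeasurableSet {x : Fin n → E | |(empiricalMeasure x).real A - μ.real A| < s} :=
    measurableSet_lt (continuous_abs.measurable.comp
      ((measurable_empiricalMeasure_real hA).sub_const _)) measurable_const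
  have hcompl : {x : Fin n → E | s ≤ |(empiricalMeasure x).real A - μ.real A|} =
      {x : Fin n → E | |(empiricalMeasure x).real A - μ.real A| < s}ᶜ := by
    ext x
    simp
  have hn' : (0 : ℝ) < n := by exact_mod_cast hn
  have hbound : Var[fun x => (empiricalMeasure x).real A; ν] / s ^ 2 ≤ μ.real A / (n * s ^ 2) := by
    rw [← div_div]
    exact div_le_div_of_nonneg_right (variance_empiricalMeasure_real_le hn μ hA) (sq_nonneg s)
  have h1 : ν.real {x : Fin n → E | s ≤ |(empiricalMeasure x).real A - μ.real A|} ≤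
      μ.real A / (n * s ^ 2) :=
    ENNReal.toReal_le_of_le_ofReal (by positivity)
      (hch.trans (ENNReal.ofReal_le_ofReal hbound))
  rw [hcompl, probReal_compl_eq_one_sub hms] at h1
  linarith

/-- The deviation inequality for a sequence of events. -/
theorem measureReal_exists_deviation_gt_le [Nonempty E] {n : ℕ} (hn : 0 < n) (μ : Measure E)
    [IsProbabilityMeasure μ] {𝒜 : Set (Set E)} {𝔸 : Set E} (h𝔸 : MeasurableSet 𝔸)
    (A : ℕ → Set E) (hA : ∀ k, A k ∈ 𝒜) (hAm : ∀ k, MeasurableSet (A k)) (hA𝔸 : ∀ k, A k ⊆ 𝔸)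
    (hp : 0 < μ.real 𝔸) {δ : ℝ} (hδ : δ ∈ Set.Ioo (0 : ℝ) 1)
    (hnp : 8 / 3 * Real.log (3 / δ) ≤ n * μ.real 𝔸) {t : ℝ} (ht : 0 < t)
    (htL : n * t ^ 2 = 8 * μ.real 𝔸 *
      (Real.log (12 / δ) + Real.log (shatterCoeff 𝒜 (2 * n)))) :
    (Measure.pi fun _ : Fin n => μ).real
      {x | ∃ k, t < |(empiricalMeasure x).real (A k) - μ.real (A k)|} ≤ δ := by
  obtain ⟨hδ0, hδ1⟩ := hδ
  set p := μ.real 𝔸 with hpdef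
  set ν := Measure.pi fun _ : Fin n => μ with hν
  have hn' : (0 : ℝ) < n := by exact_mod_cast hn
  rcases le_or_gt (2 * p) t with htp | htp
  · calc _ ≤ ν.real {x | 2 * p < (empiricalMeasure x).real 𝔸} := by
          refine measureReal_mono ?_
          rintro x ⟨k, hk⟩
          have h1 : (empiricalMeasure x).real (A k) ≤ (empiricalMeasure x).real 𝔸 :=
            measureReal_mono (hA𝔸 k)
          have h2 : μ.real (A k) ≤ p := measureReal_mono (hA𝔸 k)
          have h3 : 0 ≤ (empiricalMeasure x).real (A k) := measureReal_nonneg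
          have h4 : 0 ≤ μ.real (A k) := measureReal_nonneg
          change 2 * p < (empiricalMeasure x).real 𝔸
          rcases lt_abs.1 hk with h | h <;> linarith
      _ ≤ Real.exp (-(3 / 8 * (n * p))) := measureReal_two_mul_lt_empiricalMeasure_le hn μ h𝔸
      _ ≤ Real.exp (-Real.log (3 / δ)) := Real.exp_le_exp.2 (by linarith)
      _ = δ / 3 := by rw [Real.exp_neg, Real.exp_log (by positivity), inv_div]
      _ ≤ δ := by linarith
  set S : ℝ := (shatterCoeff 𝒜 (2 * n) : ℝ) with hS
  have hS1 : 1 ≤ S := by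
    rw [hS]
    exact_mod_cast one_le_shatterCoeff ⟨A 0, hA 0⟩ (2 * n)
  set L := Real.log (12 / δ) + Real.log S with hL
  have hL1 : 12 / 5 ≤ L := by
    have h1 : Real.log 12 ≤ Real.log (12 / δ) :=
      Real.log_le_log (by norm_num) (by rw [le_div_iff₀ hδ0]; linarith)
    linarith [log_twelve_ge, Real.log_nonneg hS1]
  have hexpL : Real.exp (-L) = δ / (12 * S) := by
    rw [hL, ← Real.log_mul (by positivity) (by positivity), Real.exp_neg,
      Real.exp_log (by positivity), div_mul_eq_mul_div, inv_div]
  -- Chebyshev at `t/4` fails with probability at most `16 p / (n t²) = 2 / L ≤ 5/6`, because `L ≥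
  -- 12/5`.
  have hcheb (k : ℕ) : 1 / 6 ≤
      ν.real {y | |(empiricalMeasure y).real (A k) - μ.real (A k)| < t - 3 / 4 * t} := by
    rw [show t - 3 / 4 * t = t / 4 by ring]
    refine le_trans ?_ (measureReal_abs_empiricalMeasure_sub_lt_ge hn μ (hAm k) (s := t / 4)
      (by positivity))
    have h1 : μ.real (A k) ≤ p := measureReal_mono (hA𝔸 k)
    have h2 : μ.real (A k) / (n * (t / 4) ^ 2) ≤ 5 / 6 := by
      rw [div_le_iff₀ (by positivity)]
      have : (n : ℝ) * (t / 4) ^ 2 = p * L / 2 := by linear_combination htL / 16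
      rw [this]
      nlinarith
    linarith
  have hsymm := mul_measureReal_exists_abs_sub_gt_le ν
    (fun k x => (empiricalMeasure x).real (A k)) (fun k => μ.real (A k)) (by norm_num)
    (fun k => measurable_empiricalMeasure_real (hAm k)) hcheb
  -- The minimizer of the exponent when `cosh l - 1` is replaced by `l² / 2`; `t < 2p` gives `l ≤
  -- 3/4`.
  set l := 3 * t / (8 * p) with hl
  have hl0 : 0 ≤ l := by positivity
  have hl1 : l ≤ 3 / 4 := by
    rw [hl, div_le_iff₀ (by positivity)]; linarith
  have hlp : l * p = 3 * t / 8 := by rw [hl]; field_simp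
  have hpair : (ν.prod ν).real {w | ∃ k, 3 / 4 * t <
      |(empiricalMeasure w.1).real (A k) - (empiricalMeasure w.2).real (A k)|} =
      (Measure.pi fun _ : Fin n => μ.prod μ).real
        {z | ∃ k, n * (3 / 4 * t) < |∑ i, indicatorDiff z (A k) i|} := by
    have hmp := measurePreserving_arrowProdEquivProdArrow E E (Fin n) (fun _ => μ) (fun _ => μ)
    rw [measureReal_def, measureReal_def, hν, ← hmp.measure_preimage_equiv]
    congr 2
    ext z
    refine exists_congr fun k => ?_
    change 3 / 4 * t < |(empiricalMeasure fun i => (z i).1).real (A k) -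
      (empiricalMeasure fun i => (z i).2).real (A k)| ↔ _
    rw [empiricalMeasure_real_eq _ (hAm k), empiricalMeasure_real_eq _ (hAm k),
      ← Finset.sum_sub_distrib]
    simp_rw [← sub_div]
    rw [← Finset.sum_div, abs_div, abs_of_pos hn', lt_div_iff₀ hn', mul_comm]
    rfl
  have htail := measureReal_exists_abs_sum_indicatorDiff_gt_le (n := n) μ h𝔸 A hA hAm hA𝔸 hl0
    (n * (3 / 4 * t))
  -- Since `n t l = 3L`, the bound with constant `5/9` is `(5/12 - 3/4) · 3L = -L` exactly.
  have hexpo : 2 * n * p * (Real.cosh l - 1) - l * (n * (3 / 4 * t)) ≤ -L := by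
    have h1 : 2 * n * p * (Real.cosh l - 1) ≤ 2 * n * p * (5 / 9 * l ^ 2) := by
      gcongr
      exact cosh_sub_one_le hl0 hl1
    have h2 : 2 * n * p * (5 / 9 * l ^ 2) = 5 / 12 * (n * t * l) := by
      linear_combination (10 / 9 * n * l) * hlp
    have h3 : n * t * l = 3 * L := by
      rw [hl, ← mul_div_assoc, div_eq_iff (by positivity)]
      linear_combination 3 * htL
    linarith
  rw [hpair] at hsymm
  have hfin : 2 * S * Real.exp (2 * n * p * (Real.cosh l - 1) - l * (n * (3 / 4 * t))) ≤
      δ / 6 := by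
    calc _ ≤ 2 * S * Real.exp (-L) := by gcongr
      _ = δ / 6 := by rw [hexpL]; field_simp; norm_num
  -- The `12` in `L` is used up here: `2 S exp (-L) = δ/6`, and symmetrization costs a factor 6.
  linarith

end Tails

/-! ### Transfer from the product space to `Ω`. -/

theorem mainTheorem9 {d n : ℕ}
    {Ω : Type*} [MeasurableSpace Ω] (P : Measure Ω) [IsProbabilityMeasure P]
    (μ : Measure (EuclideanSpace ℝ (Fin d))) [IsProbabilityMeasure μ]
    (X : Fin n → Ω → EuclideanSpace ℝ (Fin d))
    (hX_meas : ∀ i, Measurable (X i))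
    (hX_indep : iIndepFun X P)
    (hX_law : ∀ i, P.map (X i) = μ)
    (𝒜 : Set (Set (EuclideanSpace ℝ (Fin d))))
    (h𝒜_ne : 𝒜.Nonempty)
    (h𝒜_meas : ∀ A ∈ 𝒜, MeasurableSet A)
    (h𝒜_pm : PointwiseMeasurable 𝒜)
    (𝔸 : Set (EuclideanSpace ℝ (Fin d))) (h𝔸_meas : MeasurableSet 𝔸)
    (h𝔸 : ∀ A ∈ 𝒜, A ⊆ 𝔸)
    (p : ℝ) (hp : p = μ.real 𝔸)
    (δ : ℝ) (hδ : δ ∈ Set.Ioo (0 : ℝ) 1)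
    (hnp : (8 / 3 : ℝ) * Real.log (3 / δ) ≤ n * p) :
    Measurable (fun ω => maxDeviation μ 𝒜 (fun i => X i ω)) ∧
      1 - δ ≤ P.real {ω | maxDeviation μ 𝒜 (fun i => X i ω) ≤
        2 * √((2 * p / n) * (Real.log (12 / δ) + Real.log (shatterCoeff 𝒜 (2 * n))))} := by
  obtain ⟨A, hA, hlim⟩ := h𝒜_pm.exists_seq h𝒜_ne
  have hAm (k : ℕ) : MeasurableSet (A k) := h𝒜_meas _ (hA k)
  have hXm : Measurable fun ω i => X i ω := measurable_pi_lambda _ hX_meas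
  have hdev (k : ℕ) : Measurable fun x : Fin n → EuclideanSpace ℝ (Fin d) =>
      |(empiricalMeasure x).real (A k) - μ.real (A k)| :=
    continuous_abs.measurable.comp ((measurable_empiricalMeasure_real (hAm k)).sub_const _)
  simp_rw [maxDeviation_eq_iSup μ hA hAm hlim]
  refine ⟨Measurable.iSup fun k => (hdev k).comp hXm, ?_⟩
  simp_rw [iSup_abs_sub_real_le_iff]
  have hδ0 := hδ.1
  have hδ1 := hδ.2
  have hlog3 : 0 < Real.log (3 / δ) := Real.log_pos (by rw [lt_div_iff₀ hδ0]; linarith)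
  have hnp0 : 0 < n * p := by linarith
  -- The lower bound on `n p` is positive, which excludes both `n = 0` and `p = 0`.
  have hn : 0 < n := by
    rcases Nat.eq_zero_or_pos n with rfl | h
    · simp at hnp0
    · exact h
  have hn' : (0 : ℝ) < n := by exact_mod_cast hn
  have hp0 : 0 < p := (pos_iff_pos_of_mul_pos hnp0).1 hn'
  have hS1 : (1 : ℝ) ≤ shatterCoeff 𝒜 (2 * n) := by
    exact_mod_cast one_le_shatterCoeff h𝒜_ne (2 * n)
  have hL0 : 0 < Real.log (12 / δ) + Real.log (shatterCoeff 𝒜 (2 * n)) :=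
    add_pos_of_pos_of_nonneg (Real.log_pos (by rw [lt_div_iff₀ hδ0]; linarith))
      (Real.log_nonneg hS1)
  set t := 2 * √((2 * p / n) * (Real.log (12 / δ) + Real.log (shatterCoeff 𝒜 (2 * n)))) with ht
  have ht0 : 0 < t := by positivity
  have htL : n * t ^ 2 = 8 * p * (Real.log (12 / δ) + Real.log (shatterCoeff 𝒜 (2 * n))) := by
    rw [ht, mul_pow, Real.sq_sqrt (by positivity)]
    field_simp
    norm_num
  subst hp
  have hbad := measureReal_exists_deviation_gt_le hn μ h𝔸_meas A hA hAm (fun k => h𝔸 _ (hA k)) hp0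
    hδ hnp ht0 htL
  have hlaw : P.map (fun ω i => X i ω) = Measure.pi fun _ : Fin n => μ := by
    rw [hX_indep.map_fun_eq_pi_map fun i => (hX_meas i).aemeasurable]
    simp_rw [hX_law]
  have hgood : MeasurableSet {x : Fin n → EuclideanSpace ℝ (Fin d) |
      ∀ k, |(empiricalMeasure x).real (A k) - μ.real (A k)| ≤ t} := by
    rw [Set.ofPred_forall]
    exact .iInter fun k => measurableSet_le (hdev k) measurable_const
  have hcompl : {x : Fin n → EuclideanSpace ℝ (Fin d) |
      ∃ k, t < |(empiricalMeasure x).real (A k) - μ.real (A k)|} =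
      {x | ∀ k, |(empiricalMeasure x).real (A k) - μ.real (A k)| ≤ t}ᶜ := by
    ext x
    simp
  rw [hcompl, probReal_compl_eq_one_sub hgood, ← hlaw, map_measureReal_apply hXm hgood] at hbad
  change 1 - δ ≤ P.real ((fun ω i => X i ω) ⁻¹' {x | ∀ k,
    |(empiricalMeasure x).real (A k) - μ.real (A k)| ≤ t})
  linarith
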